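/- **Theorem 2.** Let $(q)_N=\prod_{m=1}^{N}(1-q^m)$ for integers $N\ge 0$, and for integers $N\ge 0$ and $M$ put $\left[{N\atop M}\right]_q=\dfrac{(q)_N}{(q)_M(q)_{N-M}}$ if $0\le M\le N$ and $\left[{N\atop M}\right]_q=0$ otherwise; $\left[{N\atop M}\right]_{q^2}$ is obtained from it by replacing $q$ by $q^2$. Let $n,k,i$ be non-negative integers with $k\ge 2$ and $1\le i\le k$. Then all but finitely many terms of the sum on the left below vanish, and the following identity of polynomials in $q$ with integer coefficients holds: $$ \sum_{r=-\infty}^{\infty}(-1)^r q^{r(kr+k-i)}\left[{2n+k-i\atop n-kr}\right]_q =\sum_{\substack{n_1\ge\cdots\ge n_{k-1}\ge 0\\ n_1+\cdots+n_{k-1}\le n}} q^{n_1^2+\cdots+n_{k-1}^2+n_i+\cdots+n_{k-1}} \prod_{j=1}^{k-2}\left[{2n-2(n_1+\cdots+n_{j-1})-n_j-n_{j+1}+\beta^{(k)}_{ij}\atop n_j-n_{j+1}}\right]_q \cdot\left[{n-(n_1+\cdots+n_{k-2})\atop n_{k-1}}\right]_{q^2}, $$ where the outer sum is over integers $n_1,\dots,n_{k-1}$,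 the sum $n_i+\cdots+n_{k-1}$ is empty for $i=k$, and $\beta^{(k)}_{ij}=\min(k-i,\,k-1-j)$ for $1\le i\le k$, $1\le j\le k-2$ are the entries of the $k\times(k-2)$ matrix $$B^{(k)}=\begin{pmatrix} k-2&k-3&k-4&\cdots&1\\ k-2&k-3&k-4&\cdots&1\\ k-3&k-3&k-4&\cdots&1\\ \vdots&&&&\vdots\\ 2&2&\cdots&2&1\\ 1&1&\cdots&1&1\\ 0&0&\cdots&0&0 \end{pmatrix}.$$ -/

import Mathlib

open Polynomial

/-- The `q`-shifted factorial `(q)_n = (1 - q)(1 - q^2) ⋯ (1 - q^n)`. -/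
def qFact {R : Type*} [CommRing R] (q : R) (n : ℕ) : R :=
  ∏ m ∈ Finset.range n, (1 - q ^ (m + 1))

/-- The Gaussian binomial coefficient with natural arguments, as a polynomial expression in `q`,
by the `q`-Pascal rule. -/
def gaussBinomNat {R : Type*} [CommRing R] (q : R) : ℕ → ℕ → R
  | _, 0 => 1
  | 0, _ + 1 => 0
  | N + 1, M + 1 => gaussBinomNat q N M + q ^ (M + 1) * gaussBinomNat q N (M + 1)

/-- The symbol `[N, M]_q`: the Gaussian binomial coefficient `(q)_N / ((q)_M (q)_{N-M})`
for `0 ≤ M ≤ N`, and zero otherwise. -/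
def gaussBinom {R : Type*} [CommRing R] (q : R) (N M : ℤ) : R :=
  if 0 ≤ M ∧ M ≤ N then gaussBinomNat q N.toNat M.toNat else 0

theorem gaussBinomNat_eq_zero {R : Type*} [CommRing R] (q : R) (N : ℕ) :
    ∀ M : ℕ, N < M → gaussBinomNat q N M = 0 := by
  induction N with
  | zero =>
    intro M h
    obtain ⟨M, rfl⟩ : ∃ m, M = m + 1 := ⟨M - 1, by omega⟩
    simp [gaussBinomNat]
  | succ N ih =>
    intro M h
    obtain ⟨M, rfl⟩ : ∃ m, M = m + 1 := ⟨M - 1, by omega⟩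
    simp [gaussBinomNat, ih M (by omega), ih (M + 1) (by omega)]

theorem gaussBinomNat_mul {R : Type*} [CommRing R] (q : R) (s : ℕ) :
    ∀ a b : ℕ, a + b = s →
      gaussBinomNat q s a * (qFact q a * qFact q b) = qFact q s := by
  induction s with
  | zero =>
    intro a b h
    obtain ⟨rfl, rfl⟩ : a = 0 ∧ b = 0 := by omega
    simp [gaussBinomNat, qFact]
  | succ s ih =>
    intro a b h
    rcases a with _ | a
    · obtain rfl : b = s + 1 := by omega
      simp [gaussBinomNat, qFact]
    · have hs : ∀ t : ℕ, qFact q (t + 1) = qFact q t * (1 - q ^ (t + 1)) := fun t => by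
        simp [qFact, Finset.prod_range_succ]
      have h1 := ih a b (by omega)
      rcases b with _ | b
      · obtain rfl : a = s := by omega
        have h0 : gaussBinomNat q a (a + 1) = 0 := gaussBinomNat_eq_zero q a (a + 1) (by omega)
        rw [gaussBinomNat, h0, hs]
        linear_combination (1 - q ^ (a + 1)) * h1
      · have h2 := ih (a + 1) b (by omega)
        obtain rfl : s = a + b + 1 := by omega
        rw [hs] at h1 h2
        rw [gaussBinomNat, hs a, hs b, hs (a + b + 1)]
        linear_combination (1 - q ^ (a + 1)) * h1 + q ^ (a + 1) * (1 - q ^ (b + 1)) * h2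

/-- The symbol `[N, M]_q` is the quotient `(q)_N / ((q)_M (q)_{N-M})` for `0 ≤ M ≤ N`. -/
theorem gaussBinom_mul {R : Type*} [CommRing R] (q : R) (N M : ℤ) (h0 : 0 ≤ M) (h1 : M ≤ N) :
    gaussBinom q N M * (qFact q M.toNat * qFact q (N - M).toNat) = qFact q N.toNat := by
  rw [gaussBinom, if_pos ⟨h0, h1⟩]
  exact gaussBinomNat_mul q N.toNat M.toNat (N - M).toNat (by omega)

/-- The entry `β_{ij}` of the `k × (k-2)` matrix `B^{(k)}`
(rows `1 ≤ i ≤ k` and columns `1 ≤ j ≤ k - 2`, counted from one). -/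
def betaEntry (k i j : ℕ) : ℤ := min ((k : ℤ) - i) ((k : ℤ) - 1 - j)

/-- The index set of the multisum: the weakly decreasing tuples
`(n_1, …, n_{k-1})` of natural numbers with `n_1 + ⋯ + n_{k-1} ≤ n`.
Every part is at most `n`, so the tuples are found inside a finite box. -/
def decreasingTuples (k n : ℕ) : Finset (Fin (k - 1) → ℕ) :=
  {v ∈ Fintype.piFinset (fun _ : Fin (k - 1) => Finset.range (n + 1)) |
    (∀ a b : Fin (k - 1), a ≤ b → v b ≤ v a) ∧ ∑ a, v a ≤ n}

theorem mem_decreasingTuples (k n : ℕ) (v : Fin (k - 1) → ℕ) :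
    v ∈ decreasingTuples k n ↔ Antitone v ∧ ∑ a, v a ≤ n := by
  simp only [decreasingTuples, Finset.mem_filter, Fintype.mem_piFinset, Finset.mem_range]
  refine ⟨fun h => ⟨fun a b hab => h.2.1 a b hab, h.2.2⟩,
    fun h => ⟨fun a => ?_, fun a b hab => h.1 hab, h.2⟩⟩
  have := Finset.single_le_sum (f := v) (fun _ _ => Nat.zero_le _) (Finset.mem_univ a)
  omega

/-- The part `n_j` of a tuple `(n_1, …, n_m)`, with `j` counted from one
(and `0` for an index outside `1 ≤ j ≤ m`). -/
def part {m : ℕ} (v : Fin m → ℕ) (j : ℕ) : ℕ :=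
  if h : 1 ≤ j ∧ j ≤ m then v ⟨j - 1, by omega⟩ else 0

/-- The exponent `r (k r + k - i)` is nonnegative for every integer `r` when `1 ≤ i ≤ k`. -/
theorem exponent_nonneg (k i : ℕ) (_hi : 1 ≤ i) (hik : i ≤ k) (r : ℤ) :
    0 ≤ r * ((k : ℤ) * r + k - i) := by
  have h : (i : ℤ) ≤ k := by exact_mod_cast hik
  have h0 : (0 : ℤ) ≤ i := by positivity
  rcases le_or_gt 0 r with hr | hr
  · exact mul_nonneg hr (by nlinarith)
  · exact mul_nonneg_of_nonpos_of_nonpos hr.le (by nlinarith)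

/-- The term `(-1)^r q^{r (k r + k - i)} [2n + k - i, n - k r]_q` in `ℤ[q]`. -/
noncomputable def bosonicTerm (k i n : ℕ) (r : ℤ) : ℤ[X] :=
  (-1) ^ r.natAbs * X ^ (r * ((k : ℤ) * r + k - i)).toNat *
    gaussBinom X (2 * (n : ℤ) + k - i) ((n : ℤ) - k * r)

/-- The term of the multisum in `ℤ[q]` that belongs to the tuple `(n_1, …, n_{k-1})`. -/
noncomputable def fermionicTerm (k i n : ℕ) (v : Fin (k - 1) → ℕ) : ℤ[X] :=
  X ^ (∑ j ∈ Finset.Icc 1 (k - 1), part v j ^ 2 + ∑ j ∈ Finset.Icc i (k - 1), part v j) *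
    (∏ j ∈ Finset.Icc 1 (k - 2),
      gaussBinom X
        (2 * (n : ℤ) - 2 * ∑ l ∈ Finset.Ico 1 j, (part v l : ℤ) - part v j - part v (j + 1)
          + betaEntry k i j)
        ((part v j : ℤ) - part v (j + 1))) *
    gaussBinom (X ^ 2) ((n : ℤ) - ∑ l ∈ Finset.Icc 1 (k - 2), (part v l : ℤ)) (part v (k - 1))

/-! ### Gaussian binomials with natural arguments: `q`-Vandermonde and `q`-Saalschütz -/

section Naturals

variable {R : Type*} [CommRing R]

/-! The multisum is evaluated from the inside out by iterating the Burge transform. The innermost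
factor, to base `q ^ 2`, is an alternating sum over `r` of products `[N, M - r] [N, M + r]` to base
`q` (`sum_neg_one_pow_mul_gaussBinom`). The transform `sum_gaussBinom_mul_mul`, a form of the
`q`-Saalschütz sum, sums such a product over a part `x` with weight `q ^ (x ^ 2 + ε x)` and one more
Gaussian binomial. The result is again a product of two, with the next part `M` in place of `x`,
times `q ^ (r ^ 2 + ε r)`. Each inner summation therefore only changes the upper arguments and the
power of `q` in the `r`-th term. The outermost sum, over `n_1`, carries no extra binomial; there
`q`-Vandermonde (`sum_gaussBinom_mul`) merges the pair into the single binomial on the left of the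
identity.

The `s = k - i` innermost parts have linear terms, `ε = 1`, and the others have `ε = 0`. The
transform needs lower arguments `x - r` and `x + r + ε`, so the product must change shape where `ε`
changes. This is done by `sum_gaussBinom_reflect`: the `q`-Pascal rule splits off a sum that is odd
under `r ↦ -1 - r`. It is applied to the initial alternating sum and, when `i ≥ 2`, again after `s`
transforms. -/

@[simp] theorem gaussBinomNat_zero_right (q : R) (N : ℕ) : gaussBinomNat q N 0 = 1 := by
  cases N <;> rfl

theorem gaussBinomNat_succ_succ (q : R) (N M : ℕ) :
    gaussBinomNat q (N + 1) (M + 1) =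
      gaussBinomNat q N M + q ^ (M + 1) * gaussBinomNat q N (M + 1) := rfl

/-- The `q`-Vandermonde sum. -/
theorem gaussBinomNat_add (q : R) (m n : ℕ) : ∀ k : ℕ,
    gaussBinomNat q (m + n) k = ∑ p ∈ Finset.HasAntidiagonal.antidiagonal k,
      q ^ (p.2 * (m - p.1)) * gaussBinomNat q m p.1 * gaussBinomNat q n p.2 := by
  induction m with
  | zero =>
    intro k
    rw [Finset.sum_eq_single (0, k)]
    · simp
    · rintro ⟨a, b⟩ hp hne
      have ha : 0 < a := by
        rcases Nat.eq_zero_or_pos a with rfl | h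
        · simp at hp; simp [hp] at hne
        · exact h
      simp [gaussBinomNat_eq_zero q 0 a ha]
    · simp
  | succ m ih =>
    intro k
    rcases k with _ | k
    · simp
    · rw [show m + 1 + n = (m + n) + 1 by ring, gaussBinomNat_succ_succ, ih k, ih (k + 1),
        Finset.Nat.sum_antidiagonal_succ, Finset.Nat.sum_antidiagonal_succ, mul_add,
        Finset.mul_sum, ← add_assoc, add_comm (∑ p ∈ Finset.HasAntidiagonal.antidiagonal k, _) (_ * _),
        add_assoc,
        ← Finset.sum_add_distrib]
      congr 1
      · simp only [gaussBinomNat_zero_right, Nat.sub_zero]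
        ring
      · refine Finset.sum_congr rfl ?_
        rintro ⟨a, b⟩ hp
        obtain rfl : a + b = k := by simpa using hp
        simp only [gaussBinomNat_succ_succ, Nat.add_sub_add_right]
        rcases Nat.lt_or_ge m (a + 1) with h | h
        · rw [gaussBinomNat_eq_zero q m (a + 1) h]; ring
        · obtain ⟨c, rfl⟩ := Nat.exists_eq_add_of_le h
          rw [show a + 1 + c - a = c + 1 by omega, show a + 1 + c - (a + 1) = c by omega]
          ring

/-- The product is a `q`-multinomial coefficient. The symmetry of its denominator in `a`, `b`, `c`
is the source of both trinomial revisions below. -/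
theorem gaussBinomNat_mul_mul {q : R} (a b c : ℕ) :
    gaussBinomNat q (a + b + c) a * gaussBinomNat q (b + c) b *
      (qFact q a * qFact q b * qFact q c) = qFact q (a + b + c) := by
  have h1 := gaussBinomNat_mul q (a + b + c) a (b + c) (by ring)
  have h2 := gaussBinomNat_mul q (b + c) b c rfl
  rw [← h1, ← h2]
  ring

variable [IsDomain R]

/-- Since `q` is not a root of unity, shifted factorials can be cancelled in the domain, which
replaces division. -/
theorem qFact_ne_zero {q : R} (hq : ∀ n : ℕ, q ^ (n + 1) ≠ 1) (n : ℕ) : qFact q n ≠ 0 :=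
  Finset.prod_ne_zero_iff.2 fun m _ => sub_ne_zero.2 (hq m).symm

theorem gaussBinomNat_symm {q : R} (hq : ∀ n : ℕ, q ^ (n + 1) ≠ 1) (a b : ℕ) :
    gaussBinomNat q (a + b) a = gaussBinomNat q (a + b) b := by
  have h1 := gaussBinomNat_mul q (a + b) a b rfl
  have h2 := gaussBinomNat_mul q (a + b) b a (add_comm _ _)
  have h := mul_ne_zero (qFact_ne_zero hq a) (qFact_ne_zero hq b)
  refine mul_right_cancel₀ h ?_
  rw [h1, ← h2, mul_comm (qFact q b)]

/-- Trinomial revision, in the form `[N, a] [N - a, b] = [N, b] [N - b, a]`. -/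
theorem gaussBinomNat_mul_comm {q : R} (hq : ∀ n : ℕ, q ^ (n + 1) ≠ 1) (a b c : ℕ) :
    gaussBinomNat q (a + b + c) a * gaussBinomNat q (b + c) b =
      gaussBinomNat q (a + b + c) b * gaussBinomNat q (a + c) a := by
  have h1 := gaussBinomNat_mul_mul (q := q) a b c
  have h2 := gaussBinomNat_mul_mul (q := q) b a c
  have h := mul_ne_zero (mul_ne_zero (qFact_ne_zero hq a) (qFact_ne_zero hq b))
    (qFact_ne_zero hq c)
  refine mul_right_cancel₀ h ?_
  rw [h1, add_comm a b, ← h2]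
  ring

/-- Trinomial revision, in the form `[N, a] [N - a, b] = [N, a + b] [a + b, a]`. -/
theorem gaussBinomNat_mul_sub {q : R} (hq : ∀ n : ℕ, q ^ (n + 1) ≠ 1) (a b c : ℕ) :
    gaussBinomNat q (a + b + c) a * gaussBinomNat q (b + c) b =
      gaussBinomNat q (a + b + c) (a + b) * gaussBinomNat q (a + b) a := by
  have h1 := gaussBinomNat_mul_mul (q := q) a b c
  have h2 := gaussBinomNat_mul q (a + b + c) (a + b) c rfl
  have h3 := gaussBinomNat_mul q (a + b) a b rfl
  have h := mul_ne_zero (mul_ne_zero (qFact_ne_zero hq a) (qFact_ne_zero hq b))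
    (qFact_ne_zero hq c)
  refine mul_right_cancel₀ h ?_
  rw [h1, ← h2, ← h3]
  ring

/-- The `q`-Vandermonde sum, summed over the difference of the lower arguments. -/
theorem sum_gaussBinomNat_mul {q : R} (hq : ∀ n : ℕ, q ^ (n + 1) ≠ 1) (x e d N : ℕ)
    (hN : x ≤ N ∨ e ≤ N) :
    ∑ j ∈ Finset.range (N + 1),
      q ^ (j * (j + d)) * gaussBinomNat q x j * gaussBinomNat q (e + d) (j + d) =
      gaussBinomNat q (x + (e + d)) e := by
  rw [add_comm x, gaussBinomNat_add, ← Finset.Nat.sum_antidiagonal_swap,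
    Finset.Nat.sum_antidiagonal_eq_sum_range_succ_mk]
  -- Nonzero terms have `j ≤ min x e`, so under either alternative of `hN` the ranges up to `N` and
  -- up to `e` both contain them all.
  have hz : ∀ j, ¬ (j ≤ x ∧ j ≤ e) →
      gaussBinomNat q x j * gaussBinomNat q (e + d) (j + d) = 0 := by
    intro j hj
    rcases Nat.lt_or_ge x j with h | h
    · rw [gaussBinomNat_eq_zero q x j h, zero_mul]
    · rw [gaussBinomNat_eq_zero q (e + d) (j + d) (by omega), mul_zero]
  have hl : ∑ j ∈ Finset.range (N + 1),
      q ^ (j * (j + d)) * gaussBinomNat q x j * gaussBinomNat q (e + d) (j + d) =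
      ∑ j ∈ Finset.range (e + 1),
      q ^ (j * (j + d)) * gaussBinomNat q x j * gaussBinomNat q (e + d) (j + d) := by
    rcases le_total N e with h | h
    · refine Finset.sum_subset (Finset.range_mono (by omega)) fun j _ hj => ?_
      rw [mul_assoc, hz j (by simp at hj; omega), mul_zero]
    · refine (Finset.sum_subset (Finset.range_mono (by omega)) fun j _ hj => ?_).symm
      rw [mul_assoc, hz j (by simp at hj; omega), mul_zero]
  rw [hl]
  refine Finset.sum_congr rfl fun j hj => ?_
  obtain ⟨c, rfl⟩ := Nat.exists_eq_add_of_le (Nat.lt_succ_iff.1 (Finset.mem_range.1 hj))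
  simp only [Prod.swap, Nat.add_sub_cancel_left]
  rw [show j + c + d - c = j + d by omega, show j + c + d = c + (j + d) by ring,
    gaussBinomNat_symm hq c (j + d)]
  ring

/-- A polynomial form of the `q`-Saalschütz sum. -/
theorem sum_gaussBinomNat_mul_mul {q : R} (hq : ∀ n : ℕ, q ^ (n + 1) ≠ 1) (x y d N : ℕ) :
    ∑ j ∈ Finset.range (N + 1), q ^ (j * (j + d)) * gaussBinomNat q x j *
        gaussBinomNat q y (j + d) * gaussBinomNat q (x + y + N - j) (N - j) =
      gaussBinomNat q (x + N + d) N * gaussBinomNat q (y + N) (N + d) := by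
  rcases Nat.lt_or_ge y d with hy | hy
  · rw [gaussBinomNat_eq_zero q (y + N) (N + d) (by omega), mul_zero]
    refine Finset.sum_eq_zero fun j _ => ?_
    rw [gaussBinomNat_eq_zero q y (j + d) (by omega)]
    ring
  obtain ⟨e, rfl⟩ := Nat.exists_eq_add_of_le' hy
  -- Vandermonde expands the last factor along `(x - j) + (y + N)`. With summation index `p - j`,
  -- trinomial revision turns `[x, j] [x - j, p - j]` into `[x, p] [p, j]`.
  have h1 : ∀ j ∈ Finset.range (N + 1), q ^ (j * (j + d)) * gaussBinomNat q x j *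
      gaussBinomNat q (e + d) (j + d) * gaussBinomNat q (x + (e + d) + N - j) (N - j) =
      ∑ p ∈ Finset.range (N + 1), (q ^ ((N - p) * (x - p)) * gaussBinomNat q x p *
        gaussBinomNat q (e + d + N) (N - p)) * (q ^ (j * (j + d)) * gaussBinomNat q p j *
        gaussBinomNat q (e + d) (j + d)) := by
    intro j hj
    rcases Nat.lt_or_ge x j with hx | hx
    · rw [gaussBinomNat_eq_zero q x j hx, mul_zero, zero_mul, zero_mul]
      refine (Finset.sum_eq_zero fun p _ => ?_).symm
      rcases Nat.lt_or_ge x p with hp | hp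
      · rw [gaussBinomNat_eq_zero q x p hp]; ring
      · rw [gaussBinomNat_eq_zero q p j (by omega)]; ring
    · obtain ⟨c, rfl⟩ := Nat.exists_eq_add_of_le (Nat.lt_succ_iff.1 (Finset.mem_range.1 hj))
      obtain ⟨w, rfl⟩ := Nat.exists_eq_add_of_le hx
      rw [show j + w + (e + d) + (j + c) - j = w + (e + d + (j + c)) by omega,
        show j + c - j = c by omega, gaussBinomNat_add q w (e + d + (j + c)) c,
        Finset.Nat.sum_antidiagonal_eq_sum_range_succ_mk, Finset.mul_sum,
        show j + c + 1 = j + (c + 1) by ring, Finset.sum_range_add]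
      symm
      refine (congrArg₂ (· + ·) (Finset.sum_eq_zero fun p hp => ?_)
        (Finset.sum_congr rfl fun l _ => ?_)).trans (zero_add _)
      · rw [gaussBinomNat_eq_zero q p j (Finset.mem_range.1 hp)]; ring
      · simp only [Nat.add_sub_add_left]
        rcases Nat.lt_or_ge w l with hl | hl
        · rw [gaussBinomNat_eq_zero q w l hl, gaussBinomNat_eq_zero q (j + w) (j + l) (by omega)]
          ring
        · obtain ⟨t, rfl⟩ := Nat.exists_eq_add_of_le hl
          have := gaussBinomNat_mul_sub hq j l t
          rw [add_assoc] at this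
          linear_combination -q ^ (j * (j + d)) * gaussBinomNat q (e + d) (j + d) *
            q ^ ((c - l) * (l + t - l)) * gaussBinomNat q (e + d + (j + c)) (c - l) * this
  rw [Finset.sum_congr rfl h1, Finset.sum_comm]
  -- The sum over `j` is now a Vandermonde sum. A second revision extracts a factor free of `p`, and
  -- what remains is a Vandermonde sum over `p`.
  have h2 : ∀ p ∈ Finset.range (N + 1), ∑ j ∈ Finset.range (N + 1),
      (q ^ ((N - p) * (x - p)) * gaussBinomNat q x p *
        gaussBinomNat q (e + d + N) (N - p)) * (q ^ (j * (j + d)) * gaussBinomNat q p j *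
        gaussBinomNat q (e + d) (j + d)) =
      gaussBinomNat q (e + d + N) (N + d) *
        (q ^ ((N - p) * (x - p)) * gaussBinomNat q x p * gaussBinomNat q (N + d) (N - p)) := by
    intro p hp
    have hp' := Nat.lt_succ_iff.1 (Finset.mem_range.1 hp)
    rw [← Finset.mul_sum, sum_gaussBinomNat_mul hq p e d N (Or.inl hp')]
    obtain ⟨c, rfl⟩ := Nat.exists_eq_add_of_le' hp'
    have h := gaussBinomNat_mul_comm hq c e (p + d)
    have hs := gaussBinomNat_symm hq e (c + p + d)
    rw [show c + e + (p + d) = e + d + (c + p) by ring] at h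
    rw [show e + (c + p + d) = e + d + (c + p) by ring] at hs
    rw [show c + p - p = c by omega, ← hs, show p + (e + d) = e + (p + d) by ring,
      show c + p + d = c + (p + d) by ring]
    linear_combination q ^ (c * (x - p)) * gaussBinomNat q x p * h
  rw [Finset.sum_congr rfl h2, ← Finset.mul_sum, show x + N + d = x + (N + d) by ring,
    gaussBinomNat_add q x (N + d) N, Finset.Nat.sum_antidiagonal_eq_sum_range_succ_mk]
  ring

end Naturals

/-! ### Integer arguments and the Burge transform -/

section Integers

variable {R : Type*} [CommRing R]

theorem gaussBinom_natCast (q : R) (N M : ℕ) :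
    gaussBinom q (N : ℤ) (M : ℤ) = gaussBinomNat q N M := by
  unfold gaussBinom
  split_ifs with h
  · simp
  · exact (gaussBinomNat_eq_zero q N M (by omega)).symm

theorem gaussBinom_eq_zero (q : R) {N M : ℤ} (h : M < 0 ∨ N < M) : gaussBinom q N M = 0 :=
  if_neg (by omega)

/-- The one exception to the rule is `N = M = -1`, where the left side is `[0, 0] = 1` and the right
side is zero. -/
theorem gaussBinom_add_one (q : R) (N M : ℤ) (h : 0 ≤ N ∨ M ≠ -1) :
    gaussBinom q (N + 1) (M + 1) =
      gaussBinom q N M + q ^ (M + 1).toNat * gaussBinom q N (M + 1) := by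
  rcases lt_or_ge N 0 with hN | hN
  · rw [gaussBinom_eq_zero q (N := N + 1) (by omega), gaussBinom_eq_zero q (N := N) (by omega),
      gaussBinom_eq_zero q (N := N) (by omega)]
    ring
  obtain ⟨N, rfl⟩ := Int.eq_ofNat_of_zero_le hN
  rcases lt_trichotomy M (-1) with hM | rfl | hM
  · rw [gaussBinom_eq_zero q (by omega), gaussBinom_eq_zero q (by omega),
      gaussBinom_eq_zero q (by omega)]
    ring
  · rw [gaussBinom_eq_zero q (M := -1) (by omega)]
    have h1 := gaussBinom_natCast q N 0
    have h2 := gaussBinom_natCast q (N + 1) 0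
    push_cast at h1 h2
    simp [h1, h2]
  · obtain ⟨M, rfl⟩ := Int.eq_ofNat_of_zero_le (show 0 ≤ M by omega)
    have h1 := gaussBinom_natCast q (N + 1) (M + 1)
    have h2 := gaussBinom_natCast q N (M + 1)
    push_cast at h1 h2
    rw [h1, h2, gaussBinom_natCast, gaussBinomNat_succ_succ]
    norm_cast

theorem sum_range_eq_sum_range_add {f : ℕ → R} {b M : ℕ} (hb : b ≤ M)
    (hf : ∀ x < b, f x = 0) :
    ∑ x ∈ Finset.range (M + 1), f x = ∑ j ∈ Finset.range (M - b + 1), f (b + j) := by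
  obtain ⟨c, rfl⟩ := Nat.exists_eq_add_of_le hb
  rw [show b + c + 1 = b + (c + 1) by ring, Finset.sum_range_add,
    Finset.sum_eq_zero (fun x hx => hf x (Finset.mem_range.1 hx)), zero_add,
    Nat.add_sub_cancel_left]

variable [IsDomain R]

/-- This is `q`-Saalschütz shifted by `x = b + j`. The truncated subtraction in the exponent is
harmless, because `[A, x - b]` vanishes for `x < b`; a negative `B` makes both sides zero. -/
theorem sum_gaussBinom_mul_mul_natCast {q : R} (hq : ∀ n : ℕ, q ^ (n + 1) ≠ 1) (A : ℕ) (B : ℤ)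
    (b d M : ℕ) :
    ∑ x ∈ Finset.range (M + 1), q ^ ((x - b) * (x - b + d)) * gaussBinom q A ((x : ℤ) - b) *
      gaussBinom q B ((x : ℤ) - b + d) * gaussBinom q (A + B + M - x) ((M : ℤ) - x) =
    gaussBinom q (A + M - b + d) ((M : ℤ) - b) * gaussBinom q (B + M - b) ((M : ℤ) - b + d) := by
  rcases Nat.lt_or_ge M b with hb | hb
  · rw [gaussBinom_eq_zero q (M := (M : ℤ) - b) (by omega), zero_mul]
    refine Finset.sum_eq_zero fun x hx => ?_
    have := Finset.mem_range.1 hx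
    rw [gaussBinom_eq_zero q (M := (x : ℤ) - b) (by omega)]
    ring
  rw [sum_range_eq_sum_range_add hb]
  swap
  · intro x hx
    rw [gaussBinom_eq_zero q (M := (x : ℤ) - b) (by omega)]
    ring
  obtain ⟨N, rfl⟩ := Nat.exists_eq_add_of_le hb
  rcases lt_or_ge B 0 with hB | hB
  · rw [gaussBinom_eq_zero q (N := B + ↑(b + N) - b) (by omega), mul_zero]
    refine Finset.sum_eq_zero fun x hx => ?_
    rw [gaussBinom_eq_zero q (N := B) (by omega)]
    ring
  obtain ⟨B, rfl⟩ := Int.eq_ofNat_of_zero_le hB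
  have h := sum_gaussBinomNat_mul_mul hq A B d N
  simp only [← gaussBinom_natCast q] at h
  rw [Nat.add_sub_cancel_left]
  refine Eq.trans (Finset.sum_congr rfl fun j hj => ?_) (h.trans ?_)
  · have := Finset.mem_range.1 hj
    rw [Nat.add_sub_cancel_left, show ((b + j : ℕ) : ℤ) - b = j by push_cast; ring,
      show ((A + B + N - j : ℕ) : ℤ) = (A : ℤ) + B + ((b + N : ℕ) : ℤ) - ((b + j : ℕ) : ℤ) by omega,
      show ((N - j : ℕ) : ℤ) = ((b + N : ℕ) : ℤ) - ((b + j : ℕ) : ℤ) by omega]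
    push_cast
    ring
  · push_cast
    congr 2 <;> ring

/-- No factor `[_, M - x]` cuts off the sum here, so `h` is needed to ensure that all nonzero terms
have `x ≤ M`. -/
theorem sum_gaussBinom_mul_natCast {q : R} (hq : ∀ n : ℕ, q ^ (n + 1) ≠ 1) (A : ℕ) (B : ℤ)
    (b d M : ℕ) (h : B - d ≤ M - b) :
    ∑ x ∈ Finset.range (M + 1), q ^ ((x - b) * (x - b + d)) * gaussBinom q A ((x : ℤ) - b) *
      gaussBinom q B ((x : ℤ) - b + d) = gaussBinom q (A + B) (B - d) := by
  rcases lt_or_ge B d with hB | hB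
  · rw [gaussBinom_eq_zero q (M := B - d) (by omega)]
    refine Finset.sum_eq_zero fun x hx => ?_
    rcases Nat.lt_or_ge x b with hx | hx
    · rw [gaussBinom_eq_zero q (M := (x : ℤ) - b) (by omega)]
      ring
    · rw [gaussBinom_eq_zero q (N := B) (by omega)]
      ring
  have hb : b ≤ M := by omega
  rw [sum_range_eq_sum_range_add hb]
  swap
  · intro x hx
    rw [gaussBinom_eq_zero q (M := (x : ℤ) - b) (by omega)]
    ring
  obtain ⟨e, rfl⟩ : ∃ e : ℕ, B = e + d := ⟨(B - d).toNat, by omega⟩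
  have h := sum_gaussBinomNat_mul hq A e d (M - b) (Or.inr (by omega))
  simp only [← gaussBinom_natCast q] at h
  refine Eq.trans (Finset.sum_congr rfl fun j hj => ?_) (h.trans ?_)
  · rw [Nat.add_sub_cancel_left, show ((b + j : ℕ) : ℤ) - b = j by push_cast; ring]
    push_cast
    ring
  · push_cast
    congr 1; ring

/-- It rests on `x ^ 2 + ε x - (b ^ 2 + ε b) = (x - b) (x + b + ε)`. In use, `c` is the nonnegative
choice among `b` and `-(b + ε)`, and `d = |2 b + ε|`, so `x - c` and `x - c + d` are these two
factors in some order. -/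
theorem quadratic_toNat_eq (x ε : ℕ) (b d c : ℤ) (hc : 0 ≤ c) (hd : 0 ≤ d)
    (hx : c ≤ x) (h : (x - c) * (x - c + d) = x ^ 2 + ε * x - (b ^ 2 + ε * b))
    (hb : 0 ≤ b ^ 2 + ε * b) :
    x ^ 2 + ε * x = (b ^ 2 + ε * b).toNat + (x - c.toNat) * (x - c.toNat + d.toNat) := by
  zify
  rw [Int.toNat_of_nonneg hb, Int.toNat_of_nonneg hd, Nat.cast_sub (by omega),
    Int.toNat_of_nonneg hc, h]
  ring

theorem sq_add_mul_nonneg {ε : ℕ} (hε : ε ≤ 1) (b : ℤ) : 0 ≤ b ^ 2 + ε * b := by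
  interval_cases ε
  · simpa using sq_nonneg b
  · rcases le_or_gt 0 b with h | h
    · positivity
    · push_cast; nlinarith

/-- The Burge transform of a product of two Gaussian binomial coefficients. -/
theorem sum_gaussBinom_mul_mul {q : R} (hq : ∀ n : ℕ, q ^ (n + 1) ≠ 1) (A B b : ℤ) (M ε : ℕ)
    (hε : ε ≤ 1) (hA : 0 ≤ b → 0 ≤ A) (hB : b < 0 → 0 ≤ B) :
    ∑ x ∈ Finset.range (M + 1), q ^ (x ^ 2 + ε * x) *
      (gaussBinom q (A + B + M - x) ((M : ℤ) - x) *
        (gaussBinom q A (x - b) * gaussBinom q B (x + b + ε))) =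
    q ^ (b ^ 2 + ε * b).toNat *
      (gaussBinom q (A + M + b + ε) (M - b) * gaussBinom q (B + M - b) (M + b + ε)) := by
  rcases le_or_gt 0 b with hb | hb
  · obtain ⟨A, rfl⟩ := Int.eq_ofNat_of_zero_le (hA hb)
    have key := sum_gaussBinom_mul_mul_natCast hq A B b.toNat (2 * b + ε).toNat M
    rw [Int.toNat_of_nonneg hb, Int.toNat_of_nonneg (show 0 ≤ 2 * b + ε by omega)] at key
    rw [show (A : ℤ) + M + b + ε = A + M - b + (2 * b + ε) by ring,
      show (M : ℤ) + b + ε = M - b + (2 * b + ε) by ring, ← key, Finset.mul_sum]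
    refine Finset.sum_congr rfl fun x _ => ?_
    rw [show (x : ℤ) + b + ε = x - b + (2 * b + ε) by ring]
    rcases lt_or_ge (x : ℤ) b with hx | hx
    · rw [gaussBinom_eq_zero q (M := (x : ℤ) - b) (by omega)]
      ring
    · rw [quadratic_toNat_eq x ε b (2 * b + ε) b hb (by omega) hx (by ring)
        (sq_add_mul_nonneg hε b)]
      ring
  -- Swapping `A` with `B` and `b` with `-(b + ε)` exchanges `x - b` and `x + b + ε`, which reduces
  -- negative `b` to the nonnegative case.
  · obtain ⟨B, rfl⟩ := Int.eq_ofNat_of_zero_le (hB hb)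
    have hc : 0 ≤ -(b + ε) := by omega
    have hd : 0 ≤ -(2 * b + ε) := by omega
    have key := sum_gaussBinom_mul_mul_natCast hq B A (-(b + ε)).toNat (-(2 * b + ε)).toNat M
    rw [Int.toNat_of_nonneg hc, Int.toNat_of_nonneg hd] at key
    rw [mul_comm (gaussBinom q (A + M + b + ε) _),
      show (A : ℤ) + M + b + ε = A + M - -(b + ε) by ring,
      show (M : ℤ) - b = M - -(b + ε) + -(2 * b + ε) by ring,
      show (B : ℤ) + M - b = B + M - -(b + ε) + -(2 * b + ε) by ring,
      show (M : ℤ) + b + ε = M - -(b + ε) by ring, ← key, Finset.mul_sum]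
    refine Finset.sum_congr rfl fun x _ => ?_
    rw [show (x : ℤ) + b + ε = x - -(b + ε) by ring,
      show (x : ℤ) - b = x - -(b + ε) + -(2 * b + ε) by ring, add_comm A]
    rcases lt_or_ge (x : ℤ) (-(b + ε)) with hx | hx
    · rw [gaussBinom_eq_zero q (M := (x : ℤ) - -(b + ε)) (by omega)]
      ring
    · rw [quadratic_toNat_eq x ε b (-(2 * b + ε)) (-(b + ε)) hc hd hx (by ring)
        (sq_add_mul_nonneg hε b)]
      ring

theorem gaussBinom_symm {q : R} (hq : ∀ n : ℕ, q ^ (n + 1) ≠ 1) (N M : ℤ) :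
    gaussBinom q N (N - M) = gaussBinom q N M := by
  by_cases h : 0 ≤ M ∧ M ≤ N
  · obtain ⟨a, rfl⟩ := Int.eq_ofNat_of_zero_le h.1
    obtain ⟨b, rfl⟩ : ∃ b : ℕ, N = a + b := ⟨(N - a).toNat, by omega⟩
    rw [show (a : ℤ) + b - a = b by ring, ← Nat.cast_add, gaussBinom_natCast,
      gaussBinom_natCast, gaussBinomNat_symm hq]
  · rw [gaussBinom_eq_zero q (by omega), gaussBinom_eq_zero q (by omega)]

/-- The `q`-Vandermonde sum over integer lower arguments. -/
theorem sum_gaussBinom_mul {q : R} (hq : ∀ n : ℕ, q ^ (n + 1) ≠ 1) (A B b : ℤ) (M ε : ℕ)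
    (hε : ε ≤ 1) (hA : 0 ≤ b → 0 ≤ A ∧ B ≤ M + b + ε) (hB : b < 0 → 0 ≤ B ∧ A ≤ M - b) :
    ∑ x ∈ Finset.range (M + 1), q ^ (x ^ 2 + ε * x) *
        (gaussBinom q A (x - b) * gaussBinom q B (x + b + ε)) =
    q ^ (b ^ 2 + ε * b).toNat * gaussBinom q (A + B) (B - (2 * b + ε)) := by
  rcases le_or_gt 0 b with hb | hb
  · obtain ⟨hA, hB⟩ := hA hb
    obtain ⟨A, rfl⟩ := Int.eq_ofNat_of_zero_le hA
    have key := sum_gaussBinom_mul_natCast hq A B b.toNat (2 * b + ε).toNat M (by omega)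
    rw [Int.toNat_of_nonneg hb, Int.toNat_of_nonneg (show 0 ≤ 2 * b + ε by omega)] at key
    rw [← key, Finset.mul_sum]
    refine Finset.sum_congr rfl fun x _ => ?_
    rw [show (x : ℤ) + b + ε = x - b + (2 * b + ε) by ring]
    rcases lt_or_ge (x : ℤ) b with hx | hx
    · rw [gaussBinom_eq_zero q (M := (x : ℤ) - b) (by omega)]
      ring
    · rw [quadratic_toNat_eq x ε b (2 * b + ε) b hb (by omega) hx (by ring)
        (sq_add_mul_nonneg hε b)]
      ring
  · obtain ⟨hB, hA⟩ := hB hb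
    obtain ⟨B, rfl⟩ := Int.eq_ofNat_of_zero_le hB
    have hc : 0 ≤ -(b + ε) := by omega
    have hd : 0 ≤ -(2 * b + ε) := by omega
    have key := sum_gaussBinom_mul_natCast hq B A (-(b + ε)).toNat (-(2 * b + ε)).toNat M
      (by omega)
    rw [Int.toNat_of_nonneg hc, Int.toNat_of_nonneg hd] at key
    rw [← gaussBinom_symm hq, add_comm A,
      show (B : ℤ) + A - (B - (2 * b + ε)) = A - -(2 * b + ε) by ring, ← key, Finset.mul_sum]
    refine Finset.sum_congr rfl fun x _ => ?_
    rw [show (x : ℤ) + b + ε = x - -(b + ε) by ring,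
      show (x : ℤ) - b = x - -(b + ε) + -(2 * b + ε) by ring]
    rcases lt_or_ge (x : ℤ) (-(b + ε)) with hx | hx
    · rw [gaussBinom_eq_zero q (M := (x : ℤ) - -(b + ε)) (by omega)]
      ring
    · rw [quadratic_toNat_eq x ε b (-(2 * b + ε)) (-(b + ε)) hc hd hx (by ring)
        (sq_add_mul_nonneg hε b)]
      ring


end Integers

/-! ### The initial alternating sum, from a generating function -/

section GeneratingFunction

variable {R : Type*} [CommRing R]

/-- The power series `(1 + z) (1 + q z) ⋯ (1 + q^(N-1) z)`, through its coefficients. -/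
noncomputable def gaussSeries (q : R) (N : ℕ) : PowerSeries R :=
  PowerSeries.mk fun k => q ^ (k.choose 2) * gaussBinomNat q N k

theorem gaussSeries_zero (q : R) : gaussSeries q 0 = 1 := by
  ext k
  rcases k with _ | k
  · simp [gaussSeries]
  · simp [gaussSeries, PowerSeries.coeff_one, gaussBinomNat]

theorem succ_choose_two (k : ℕ) : (k + 1).choose 2 = k + k.choose 2 := by
  rw [Nat.choose_succ_succ', Nat.choose_one_right]

/-- The factors other than `1 + z` form the shorter product at `q z`; on coefficients this is the
`q`-Pascal rule. -/
theorem gaussSeries_succ (q : R) (N : ℕ) :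
    gaussSeries q (N + 1) = (1 + PowerSeries.X) * PowerSeries.rescale q (gaussSeries q N) := by
  ext k
  rcases k with _ | k
  · rw [PowerSeries.coeff_zero_eq_constantCoeff_apply,
      PowerSeries.coeff_zero_eq_constantCoeff_apply,
      map_mul, ← PowerSeries.coeff_zero_eq_constantCoeff_apply (PowerSeries.rescale _ _),
      PowerSeries.coeff_rescale]
    simp [gaussSeries]
  · rw [add_mul, one_mul, map_add, PowerSeries.coeff_succ_X_mul]
    simp only [gaussSeries, PowerSeries.coeff_mk, PowerSeries.coeff_rescale, succ_choose_two,
      gaussBinomNat_succ_succ]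
    ring

/-- Multiplying the product at `z` by the product at `-z` pairs the factors into `1 - q ^ (2 j) z ^
2`, which gives the same kind of product to base `q ^ 2` in `-z ^ 2`. -/
theorem coeff_gaussSeries_mul (q : R) (N : ℕ) : ∀ M : ℕ,
    PowerSeries.coeff (2 * M) (gaussSeries q N * PowerSeries.rescale (-1) (gaussSeries q N)) =
      (-1) ^ M * q ^ (2 * M.choose 2) * gaussBinomNat (q ^ 2) N M := by
  induction N with
  | zero =>
    rintro (_ | M)
    · simp [gaussSeries_zero]
    · simp [gaussSeries_zero, gaussBinomNat, PowerSeries.coeff_one]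
  | succ N ih =>
    intro M
    have h : gaussSeries q (N + 1) * PowerSeries.rescale (-1) (gaussSeries q (N + 1)) =
        (1 - PowerSeries.X ^ 2) * PowerSeries.rescale q
          (gaussSeries q N * PowerSeries.rescale (-1) (gaussSeries q N)) := by
      rw [gaussSeries_succ]
      simp only [map_mul, map_add, map_one, PowerSeries.rescale_X, PowerSeries.rescale_rescale,
        map_neg, mul_neg, neg_mul, one_mul, mul_one]
      ring
    rw [h, sub_mul, one_mul, map_sub, PowerSeries.coeff_rescale, ih]
    rcases M with _ | M
    · simp [PowerSeries.coeff_X_pow_mul']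
    · rw [show 2 * (M + 1) = 2 * M + 2 by ring, PowerSeries.coeff_X_pow_mul,
        PowerSeries.coeff_rescale, ih, gaussBinomNat_succ_succ, succ_choose_two]
      ring

/-- A finite alternating sum of products of Gaussian binomial coefficients to the base `q`
that is a Gaussian binomial coefficient to the base `q ^ 2`. -/
theorem sum_neg_one_pow_mul_gaussBinom [IsDomain R] {q : R} (hq : q ≠ 0) (N M K : ℕ)
    (hM : M ≤ K) :
    ∑ r ∈ Finset.Icc (-(K : ℤ) - 1) K, (-1) ^ r.natAbs * q ^ (r ^ 2).toNat *
      (gaussBinom q N (M - r) * gaussBinom q N (M + r)) = gaussBinom (q ^ 2) N M := by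
  have h := coeff_gaussSeries_mul q N M
  rw [PowerSeries.coeff_mul] at h
  have hne : (-1 : R) ^ M * q ^ (2 * M.choose 2) ≠ 0 :=
    mul_ne_zero (pow_ne_zero _ (neg_ne_zero.2 one_ne_zero)) (pow_ne_zero _ hq)
  refine mul_left_cancel₀ hne ?_
  rw [gaussBinom_natCast, ← h, Finset.mul_sum]
  -- Only `|r| ≤ M` contributes. The larger interval is used because it is stable under `r ↦ -1 - r`
  -- and serves all `M ≤ K` at once.
  have hsub : Finset.Icc (-(M : ℤ)) M ⊆ Finset.Icc (-(K : ℤ) - 1) K :=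
    Finset.Icc_subset_Icc (by omega) (by omega)
  rw [← Finset.sum_subset hsub]
  -- The index `r` corresponds to the pair `(M - r, M + r)` in the Cauchy product at `z ^ (2 M)`.
  · refine Finset.sum_bij' (fun r _ => ((M - r).toNat, (M + r).toNat))
      (fun p _ => (p.2 : ℤ) - M) ?_ ?_ ?_ ?_ ?_
    · intro r hr
      simp only [Finset.mem_Icc, Finset.HasAntidiagonal.mem_antidiagonal] at hr ⊢
      omega
    · rintro ⟨a, b⟩ hp
      simp only [Finset.mem_Icc, Finset.HasAntidiagonal.mem_antidiagonal] at hp ⊢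
      omega
    · intro r hr
      simp only [Finset.mem_Icc] at hr
      simp only
      omega
    · rintro ⟨a, b⟩ hp
      simp only [Finset.HasAntidiagonal.mem_antidiagonal] at hp
      simp only [Prod.mk.injEq]
      omega
    · intro r hr
      rw [Finset.mem_Icc] at hr
      obtain ⟨a, ha⟩ : ∃ a : ℕ, (M : ℤ) - r = a := ⟨(M - r).toNat, by omega⟩
      obtain ⟨b, hb⟩ : ∃ b : ℕ, (M : ℤ) + r = b := ⟨(M + r).toNat, by omega⟩
      simp only [ha, hb, Int.toNat_natCast, gaussSeries, PowerSeries.coeff_mk,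
        PowerSeries.coeff_rescale, gaussBinom_natCast]
      have h1 : (-1 : R) ^ b = (-1) ^ M * (-1) ^ r.natAbs := by
        rw [← pow_add]
        exact neg_one_pow_congr (by simp only [Nat.even_iff]; omega)
      have h2 : 2 * M.choose 2 + (r ^ 2).toNat = a.choose 2 + b.choose 2 := by
        have hc : ∀ t : ℕ, (2 * t.choose 2 : ℤ) = t ^ 2 - t := by
          intro t
          induction t with
          | zero => simp
          | succ t ih => rw [succ_choose_two]; push_cast; linarith
        zify
        rw [Int.toNat_of_nonneg (sq_nonneg r)]
        have h3 := hc a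
        have h4 := hc b
        have h5 := hc M
        rw [← ha] at h3
        rw [← hb] at h4
        linarith
      rw [h1]
      calc _ = (-1) ^ M * (-1) ^ r.natAbs * q ^ (2 * M.choose 2 + (r ^ 2).toNat) *
            (gaussBinomNat q N a * gaussBinomNat q N b) := by ring
        _ = _ := by rw [h2]; ring
  · intro r _ hr
    rw [Finset.mem_Icc] at hr
    rcases lt_or_ge (M : ℤ) r with h | h
    · rw [gaussBinom_eq_zero q (M := M - r) (by omega)]; ring
    · rw [gaussBinom_eq_zero q (M := M + r) (by omega)]; ring

end GeneratingFunction

/-! ### Iterating the Burge transform -/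

section Burge

variable {R : Type*} [CommRing R]

/-- The multisum over `n ≥ n_1 ≥ ⋯ ≥ n_m`, given the last part `M` that has been fixed and the
number `L` that is left for the sum of the parts.  The last `s` parts have linear terms in the
exponent. -/
def burgeSum (q : R) (s : ℕ) : ℕ → ℕ → ℕ → R
  | 0, L, M => gaussBinom (q ^ 2) ((L : ℤ) + M) M
  | m + 1, L, M => ∑ x ∈ Finset.range (M + 1),
      if x ≤ L then q ^ (x ^ 2 + (if m + 1 ≤ s then 1 else 0) * x) *
        (gaussBinom q (2 * (L : ℤ) + M - x + min s (m + 1)) ((M : ℤ) - x) *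
          burgeSum q s m (L - x) x)
      else 0

theorem pow_toNat_mul_pow_toNat (q : R) {a b : ℤ} (ha : 0 ≤ a) (hb : 0 ≤ b) :
    q ^ a.toNat * q ^ b.toNat = q ^ (a + b).toNat := by
  rw [← pow_add, Int.toNat_add ha hb]

theorem sq_add_self_nonneg (r : ℤ) : 0 ≤ r ^ 2 + r := by
  simpa using sq_add_mul_nonneg le_rfl r

/-- The reflection `r ↦ -1 - r` cancels one of the two terms of the `q`-Pascal rule. -/
theorem sum_gaussBinom_reflect (q : R) (L M K m : ℕ) :
    ∑ r ∈ Finset.Icc (-(K : ℤ) - 1) K, (-1) ^ r.natAbs * q ^ (r ^ 2 + m * (r ^ 2 + r)).toNat *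
      (gaussBinom q (L + M + m * r + m) (M - r) *
        gaussBinom q (L + M + 1 - m * r) (M + r + 1)) =
    ∑ r ∈ Finset.Icc (-(K : ℤ) - 1) K, (-1) ^ r.natAbs * q ^ (r ^ 2 + m * (r ^ 2 + r)).toNat *
      (gaussBinom q (L + M + m * r + m) (M - r) * gaussBinom q (L + M - m * r) (M + r)) := by
  rw [← sub_eq_zero, ← Finset.sum_sub_distrib]
  have hm : (0 : ℤ) ≤ m := by positivity
  have hterm : ∀ r : ℤ,
      (-1) ^ r.natAbs * q ^ (r ^ 2 + m * (r ^ 2 + r)).toNat *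
        (gaussBinom q (L + M + m * r + m) (M - r) *
          gaussBinom q (L + M + 1 - m * r) (M + r + 1)) -
      (-1) ^ r.natAbs * q ^ (r ^ 2 + m * (r ^ 2 + r)).toNat *
        (gaussBinom q (L + M + m * r + m) (M - r) * gaussBinom q (L + M - m * r) (M + r)) =
      (-1) ^ r.natAbs * q ^ (r ^ 2 + m * (r ^ 2 + r) + (M + r + 1)).toNat *
        (gaussBinom q (L + M + m * r + m) (M - r) *
          gaussBinom q (L + M - m * r) (M + r + 1)) := by
    intro r
    have h := gaussBinom_add_one q (L + M - m * r) (M + r) (by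
      by_cases h : (M : ℤ) + r = -1
      · left
        nlinarith
      · exact Or.inr h)
    rw [show (L : ℤ) + M + 1 - m * r = L + M - m * r + 1 by ring, h]
    rcases lt_or_ge ((M : ℤ) + r + 1) 0 with h1 | h1
    · rw [gaussBinom_eq_zero q (M := (M : ℤ) + r + 1) (by omega)]
      ring
    · rw [← pow_toNat_mul_pow_toNat q (by nlinarith [sq_add_self_nonneg r]) h1]
      ring
  rw [Finset.sum_congr rfl fun r _ => hterm r]
  -- The exponent is now `(m + 1) (r ^ 2 + r) + M + 1`, which is invariant. The two binomials trade
  -- places, and the sign changes.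
  refine Finset.sum_involution (fun r _ => -1 - r) ?_ ?_ ?_ ?_
  · intro r _
    have hs : (-1 : R) ^ (-1 - r).natAbs = -(-1) ^ r.natAbs := by
      rw [← mul_neg_one ((-1 : R) ^ r.natAbs), ← pow_succ]
      exact neg_one_pow_congr (by simp only [Nat.even_iff]; omega)
    rw [hs, show (L : ℤ) + M + m * (-1 - r) + m = L + M - m * r by ring,
      show (M : ℤ) - (-1 - r) = M + r + 1 by ring,
      show (L : ℤ) + M - m * (-1 - r) = L + M + m * r + m by ring,
      show (M : ℤ) + (-1 - r) + 1 = M - r by ring,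
      show (-1 - r) ^ 2 + m * ((-1 - r) ^ 2 + (-1 - r)) + (M - r) =
        r ^ 2 + m * (r ^ 2 + r) + (M + r + 1) by ring]
    ring
  · intro r _ _ h
    omega
  · intro r hr
    rw [Finset.mem_Icc] at hr ⊢
    omega
  · intro r _
    ring

variable [IsDomain R]

/-- One Burge transform is applied to each `r`. By `hAB`, the extra binomial it requires is the same
for all `r` and is the one in the recursion. -/
theorem burgeSum_succ {q : R} (hq : ∀ n : ℕ, q ^ (n + 1) ≠ 1) (s m L M ε : ℕ) (S : Finset ℤ)
    (hε : ε = if m + 1 ≤ s then 1 else 0) (c : ℤ → R) (A B : ℤ → ℤ)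
    (hAB : ∀ r, A r + B r = 2 * L + min s (m + 1))
    (h : ∀ x ≤ M, x ≤ L → burgeSum q s m (L - x) x =
      ∑ r ∈ S, c r * (gaussBinom q (A r) (x - r) * gaussBinom q (B r) (x + r + ε)))
    (hA : ∀ r, 0 ≤ r → 0 ≤ A r ∧ B r ≤ L + r + ε) (hB : ∀ r, r < 0 → 0 ≤ B r ∧ A r ≤ L - r) :
    burgeSum q s (m + 1) L M = ∑ r ∈ S, c r * q ^ (r ^ 2 + ε * r).toNat *
      (gaussBinom q (A r + M + r + ε) (M - r) * gaussBinom q (B r + M - r) (M + r + ε)) := by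
  have hε' : ε ≤ 1 := by rw [hε]; split_ifs <;> simp
  have key : ∀ r ∈ S, c r * q ^ (r ^ 2 + ε * r).toNat *
      (gaussBinom q (A r + M + r + ε) (M - r) * gaussBinom q (B r + M - r) (M + r + ε)) =
      ∑ x ∈ Finset.range (M + 1), c r * (q ^ (x ^ 2 + ε * x) *
      (gaussBinom q (A r + B r + M - x) ((M : ℤ) - x) *
        (gaussBinom q (A r) (x - r) * gaussBinom q (B r) (x + r + ε)))) := by
    intro r _
    rw [← Finset.mul_sum, sum_gaussBinom_mul_mul hq (A r) (B r) r M ε hε'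
      (fun hr => (hA r hr).1) (fun hr => (hB r hr).1)]
    ring
  rw [Finset.sum_congr rfl key, Finset.sum_comm, burgeSum, ← hε]
  refine Finset.sum_congr rfl fun x hx => ?_
  have hx := Nat.lt_succ_iff.1 (Finset.mem_range.1 hx)
  split_ifs with hxL
  · rw [h x hx hxL, Finset.mul_sum, Finset.mul_sum]
    refine Finset.sum_congr rfl fun r _ => ?_
    rw [hAB r, show 2 * (L : ℤ) + (min s (m + 1) : ℕ) + M - x =
      2 * L + M - x + (min s (m + 1) : ℕ) by ring]
    push_cast
    ring
  -- The transform also runs over `x > L`, absent from `burgeSum`; the upper bounds on `A` and `B`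
  -- make those terms vanish.
  · refine (Finset.sum_eq_zero fun r _ => ?_).symm
    rcases le_or_gt 0 r with hr | hr
    · rw [gaussBinom_eq_zero q (N := B r) (by have := (hA r hr).2; omega)]
      ring
    · rw [gaussBinom_eq_zero q (N := A r) (by have := (hB r hr).2; omega)]
      ring

/-- The outermost part has no accompanying binomial, so Vandermonde takes the place of Saalschütz
and leaves a single binomial. -/
theorem sum_burgeSum {q : R} (hq : ∀ n : ℕ, q ^ (n + 1) ≠ 1) (s m n ε : ℕ) (S : Finset ℤ)
    (hε : ε ≤ 1) (c : ℤ → R) (A B : ℤ → ℤ)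
    (h : ∀ x ≤ n, burgeSum q s m (n - x) x =
      ∑ r ∈ S, c r * (gaussBinom q (A r) (x - r) * gaussBinom q (B r) (x + r + ε)))
    (hA : ∀ r, 0 ≤ r → 0 ≤ A r ∧ B r ≤ n + r + ε) (hB : ∀ r, r < 0 → 0 ≤ B r ∧ A r ≤ n - r) :
    ∑ x ∈ Finset.range (n + 1), q ^ (x ^ 2 + ε * x) * burgeSum q s m (n - x) x =
      ∑ r ∈ S, c r * (q ^ (r ^ 2 + ε * r).toNat *
        gaussBinom q (A r + B r) (B r - (2 * r + ε))) := by
  have key : ∀ r ∈ S, c r * (q ^ (r ^ 2 + ε * r).toNat *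
        gaussBinom q (A r + B r) (B r - (2 * r + ε))) =
      ∑ x ∈ Finset.range (n + 1), c r * (q ^ (x ^ 2 + ε * x) *
        (gaussBinom q (A r) (x - r) * gaussBinom q (B r) (x + r + ε))) := by
    intro r _
    rw [← Finset.mul_sum, sum_gaussBinom_mul hq (A r) (B r) r n ε hε (hA r) (hB r)]
  rw [Finset.sum_congr rfl key, Finset.sum_comm]
  refine Finset.sum_congr rfl fun x hx => ?_
  rw [h x (Nat.lt_succ_iff.1 (Finset.mem_range.1 hx)), Finset.mul_sum]
  refine Finset.sum_congr rfl fun r _ => ?_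
  ring

/-- The alternating form of `burgeSum` when all its parts have linear terms in the exponent. -/
theorem burgeSum_eq_of_le {q : R} (hq : ∀ n : ℕ, q ^ (n + 1) ≠ 1) (hq0 : q ≠ 0) (s K m : ℕ)
    (hm : m ≤ s) : ∀ L M : ℕ, M ≤ K → burgeSum q s m L M =
    ∑ r ∈ Finset.Icc (-(K : ℤ) - 1) K, (-1) ^ r.natAbs * q ^ (r ^ 2 + m * (r ^ 2 + r)).toNat *
      (gaussBinom q (L + M + m * r + m) (M - r) *
        gaussBinom q (L + M + 1 - m * r) (M + r + 1)) := by
  induction m with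
  | zero =>
    intro L M hM
    have h := sum_neg_one_pow_mul_gaussBinom hq0 (L + M) M K hM
    -- The initial sum has lower arguments `M - r`, `M + r`; reflection gives it the shape required
    -- for `ε = 1`.
    rw [sum_gaussBinom_reflect, burgeSum]
    push_cast at h
    simp only [Nat.cast_zero, zero_mul, add_zero, sub_zero]
    exact h.symm
  | succ m ih =>
    intro L M hM
    rw [burgeSum_succ hq s m L M 1 (Finset.Icc (-(K : ℤ) - 1) K) (by rw [if_pos hm])
      (fun r => (-1) ^ r.natAbs * q ^ (r ^ 2 + m * (r ^ 2 + r)).toNat)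
      -- These are the upper arguments at `(L - x, x)`: they involve only `(L - x) + x = L`, hence
      -- not `x`.
      (fun r => L + m * r + m) (fun r => L + 1 - m * r)]
    · refine Finset.sum_congr rfl fun r _ => ?_
      have h2 := sq_add_self_nonneg r
      rw [mul_assoc ((-1) ^ r.natAbs), pow_toNat_mul_pow_toNat q (by positivity)
        (by simpa using h2)]
      push_cast
      congr 2
      · congr 2; ring
      · congr 1; ring
      · congr 1; ring
    · intro r
      rw [min_eq_right hm]
      push_cast
      ring
    · intro x hx hxL
      rw [ih (by omega) (L - x) x (hx.trans hM)]
      push_cast [hxL]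
      simp only [sub_add_cancel]
    · intro r hr
      have : (0 : ℤ) ≤ m * r := by positivity
      push_cast
      constructor <;> nlinarith
    · intro r hr
      have : (m : ℤ) * (r + 1) ≤ 0 := mul_nonpos_of_nonneg_of_nonpos (by positivity) (by omega)
      constructor <;> nlinarith

/-- The alternating form of `burgeSum` when at least `s` parts are summed over. -/
theorem burgeSum_add_eq {q : R} (hq : ∀ n : ℕ, q ^ (n + 1) ≠ 1) (hq0 : q ≠ 0) (s K t : ℕ) :
    ∀ L M : ℕ, M ≤ K → burgeSum q s (s + t) L M =
    ∑ r ∈ Finset.Icc (-(K : ℤ) - 1) K,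
      (-1) ^ r.natAbs * q ^ (r ^ 2 + s * (r ^ 2 + r) + t * r ^ 2).toNat *
      (gaussBinom q (L + M + (s + t) * r + s) (M - r) *
        gaussBinom q (L + M - (s + t) * r) (M + r)) := by
  induction t with
  | zero =>
    intro L M hM
    -- The remaining parts have no linear terms, so reflection returns to the shape for `ε = 0`.
    rw [add_zero, burgeSum_eq_of_le hq hq0 s K s le_rfl L M hM, sum_gaussBinom_reflect]
    simp only [Nat.cast_zero, zero_mul, add_zero]
  | succ t ih =>
    intro L M hM
    rw [← add_assoc, burgeSum_succ hq s (s + t) L M 0 (Finset.Icc (-(K : ℤ) - 1) K)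
      (by rw [if_neg (by omega)])
      (fun r => (-1) ^ r.natAbs * q ^ (r ^ 2 + s * (r ^ 2 + r) + t * r ^ 2).toNat)
      (fun r => L + (s + t) * r + s) (fun r => L - (s + t) * r)]
    · refine Finset.sum_congr rfl fun r _ => ?_
      have h2 := sq_add_self_nonneg r
      rw [mul_assoc ((-1) ^ r.natAbs), pow_toNat_mul_pow_toNat q (by positivity)
        (by simpa using sq_nonneg r)]
      push_cast
      congr 2
      · congr 2; ring
      · congr 1; ring
      · congr 1 <;> ring
    · intro r
      rw [min_eq_left (by omega)]
      ring
    · intro x hx hxL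
      rw [ih (L - x) x (hx.trans hM)]
      push_cast [hxL]
      simp only [sub_add_cancel, add_zero]
    · intro r hr
      have : (0 : ℤ) ≤ (s + t) * r := by positivity
      push_cast
      constructor <;> nlinarith
    · intro r hr
      have h1 : (s : ℤ) * (r + 1) ≤ 0 := mul_nonpos_of_nonneg_of_nonpos (by positivity) (by omega)
      have h2 : (t : ℤ) * r ≤ 0 := mul_nonpos_of_nonneg_of_nonpos (by positivity) (by omega)
      constructor <;> nlinarith

end Burge

/-! ### Unfolding the iterated sum into a sum over tuples -/

section Tuples

/-- The weakly decreasing tuples of natural numbers with parts at most `M` and sum at most `L`. -/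
def boundedTuples (m L M : ℕ) : Finset (Fin m → ℕ) :=
  {v ∈ Fintype.piFinset (fun _ : Fin m => Finset.range (M + 1)) | Antitone v ∧ ∑ a, v a ≤ L}

theorem mem_boundedTuples {m L M : ℕ} {v : Fin m → ℕ} :
    v ∈ boundedTuples m L M ↔ (∀ a, v a ≤ M) ∧ Antitone v ∧ ∑ a, v a ≤ L := by
  simp [boundedTuples]

theorem antitone_cons {m x : ℕ} {w : Fin m → ℕ} :
    Antitone (Fin.cons x w : Fin (m + 1) → ℕ) ↔ (∀ a, w a ≤ x) ∧ Antitone w := by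
  constructor
  · intro h
    refine ⟨fun a => by simpa using h (Fin.zero_le a.succ), fun a b hab => ?_⟩
    simpa using h (Fin.succ_le_succ_iff.2 hab)
  · rintro ⟨h0, h⟩ a b hab
    induction b using Fin.cases with
    | zero => rw [Fin.le_zero_iff.1 hab]
    | succ b =>
      induction a using Fin.cases with
      | zero => simpa using h0 b
      | succ a => simpa using h (Fin.succ_le_succ_iff.1 hab)

theorem cons_mem_boundedTuples {m L M x : ℕ} {w : Fin m → ℕ} :
    (Fin.cons x w : Fin (m + 1) → ℕ) ∈ boundedTuples (m + 1) L M ↔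
      x ≤ M ∧ x ≤ L ∧ w ∈ boundedTuples m (L - x) x := by
  simp only [mem_boundedTuples, antitone_cons, Fin.forall_fin_succ, Fin.cons_zero, Fin.cons_succ,
    Fin.sum_univ_succ]
  constructor
  · rintro ⟨⟨h1, _⟩, ⟨h2, h3⟩, h4⟩
    exact ⟨h1, by omega, h2, h3, by omega⟩
  · rintro ⟨h1, h2, h3, h4, h5⟩
    exact ⟨⟨h1, fun a => (h3 a).trans h1⟩, ⟨h3, h4⟩, by omega⟩

theorem sum_boundedTuples_succ {R : Type*} [AddCommMonoid R] (m L M : ℕ)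
    (f : (Fin (m + 1) → ℕ) → R) :
    ∑ v ∈ boundedTuples (m + 1) L M, f v = ∑ x ∈ Finset.range (M + 1),
      if x ≤ L then ∑ w ∈ boundedTuples m (L - x) x, f (Fin.cons x w) else 0 := by
  rw [← Finset.sum_filter, Finset.sum_sigma']
  refine Finset.sum_bij' (fun v _ => ⟨v 0, Fin.tail v⟩) (fun p _ => Fin.cons p.1 p.2)
    ?_ ?_ ?_ ?_ ?_
  · intro v hv
    rw [← Fin.cons_self_tail v, cons_mem_boundedTuples] at hv
    simp only [Finset.mem_sigma, Finset.mem_filter, Finset.mem_range]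
    exact ⟨⟨by omega, hv.2.1⟩, hv.2.2⟩
  · rintro ⟨x, w⟩ h
    simp only [Finset.mem_sigma, Finset.mem_filter, Finset.mem_range] at h
    exact cons_mem_boundedTuples.2 ⟨Nat.lt_succ_iff.1 h.1.1, h.1.2, h.2⟩
  · intro v _
    exact Fin.cons_self_tail v
  · rintro ⟨x, w⟩ _
    simp
  · intro v _
    simp

theorem decreasingTuples_eq (m n : ℕ) : decreasingTuples (m + 1) n = boundedTuples m n n := by
  ext v
  rw [mem_decreasingTuples, mem_boundedTuples]
  refine ⟨fun h => ⟨fun a => ?_, h⟩, fun h => h.2⟩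
  exact (Finset.single_le_sum (f := v) (fun _ _ => Nat.zero_le _) (Finset.mem_univ a)).trans h.2

theorem part_one_cons {m : ℕ} (x : ℕ) (w : Fin m → ℕ) :
    part (Fin.cons x w : Fin (m + 1) → ℕ) 1 = x := by
  simp [part]

theorem part_cons {m : ℕ} (x : ℕ) (w : Fin m → ℕ) (j : ℕ) :
    part (Fin.cons x w : Fin (m + 1) → ℕ) (j + 2) = part w (j + 1) := by
  unfold part
  by_cases h : j < m
  · rw [dif_pos (by omega), dif_pos (by omega)]
    exact Fin.cons_succ (α := fun _ => ℕ) x w ⟨j, h⟩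
  · rw [dif_neg (by omega), dif_neg (by omega)]

variable {R : Type*} [CommRing R]

/-- The term of the multisum that belongs to the parts `p 0, …, p m`, the last `s` of which have
linear terms in the exponent. -/
def tupleTerm (q : R) (s m : ℕ) (n : ℤ) (p : ℕ → ℕ) : R :=
  q ^ (∑ j ∈ Finset.range (m + 1), (p j ^ 2 + (if m + 1 - j ≤ s then 1 else 0) * p j)) *
    (∏ j ∈ Finset.range m,
      gaussBinom q (2 * n - 2 * ∑ l ∈ Finset.range j, (p l : ℤ) - p j - p (j + 1) +
        min s (m - j)) ((p j : ℤ) - p (j + 1))) *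
    gaussBinom (q ^ 2) (n - ∑ l ∈ Finset.range m, (p l : ℤ)) (p m)

/-- The comparisons with `s` count parts from the end, so removing the first part changes the
remaining factors only through `n`. -/
theorem tupleTerm_succ (q : R) (s m : ℕ) (n : ℤ) (p : ℕ → ℕ) :
    tupleTerm q s (m + 1) n p = q ^ (p 0 ^ 2 + (if m + 2 ≤ s then 1 else 0) * p 0) *
      (gaussBinom q (2 * n - p 0 - p 1 + min s (m + 1)) ((p 0 : ℤ) - p 1) *
        tupleTerm q s m (n - p 0) fun j => p (j + 1)) := by
  have he : ∑ j ∈ Finset.range (m + 1 + 1),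
      (p j ^ 2 + (if m + 1 + 1 - j ≤ s then 1 else 0) * p j) =
      ∑ j ∈ Finset.range (m + 1), (p (j + 1) ^ 2 + (if m + 1 - j ≤ s then 1 else 0) * p (j + 1)) +
        (p 0 ^ 2 + (if m + 2 ≤ s then 1 else 0) * p 0) := by
    rw [Finset.sum_range_succ']
    simp only [Nat.add_sub_add_right, Nat.sub_zero]
  have hp : ∀ j ∈ Finset.range m,
      gaussBinom q (2 * n - 2 * ∑ l ∈ Finset.range (j + 1), (p l : ℤ) - p (j + 1) -
        p (j + 1 + 1) + ↑(min s (m + 1 - (j + 1)))) ((p (j + 1) : ℤ) - p (j + 1 + 1)) =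
      gaussBinom q (2 * (n - p 0) - 2 * ∑ l ∈ Finset.range j, (p (l + 1) : ℤ) - p (j + 1) -
        p (j + 1 + 1) + ↑(min s (m - j))) ((p (j + 1) : ℤ) - p (j + 1 + 1)) := by
    intro j _
    rw [Finset.sum_range_succ', Nat.add_sub_add_right]
    congr 1
    ring
  have hn : n - ∑ l ∈ Finset.range (m + 1), (p l : ℤ) =
      n - p 0 - ∑ l ∈ Finset.range m, (p (l + 1) : ℤ) := by
    rw [Finset.sum_range_succ']
    ring
  unfold tupleTerm
  rw [he, hn, Finset.prod_range_succ', Finset.prod_congr rfl hp, pow_add]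
  simp only [Finset.sum_range_zero, Nat.sub_zero, mul_zero, sub_zero, zero_add]
  ring

/-- `burgeSum` omits the power of `q` belonging to the fixed part `M`; supplying it makes the
induction close on tuples with `M` prepended. -/
theorem pow_mul_burgeSum (q : R) (s m : ℕ) : ∀ L M : ℕ,
    q ^ (M ^ 2 + (if m + 1 ≤ s then 1 else 0) * M) * burgeSum q s m L M =
      ∑ v ∈ boundedTuples m L M, tupleTerm q s m ((L : ℤ) + M)
        fun j => part (Fin.cons M v : Fin (m + 1) → ℕ) (j + 1) := by
  induction m with
  | zero =>
    intro L M
    have h : boundedTuples 0 L M = {Fin.elim0} := by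
      ext v
      simp [mem_boundedTuples, Subsingleton.elim v Fin.elim0, Subsingleton.antitone]
    simp [h, tupleTerm, burgeSum, part_one_cons]
  | succ m ih =>
    intro L M
    rw [sum_boundedTuples_succ, burgeSum, Finset.mul_sum]
    refine Finset.sum_congr rfl fun x _ => ?_
    by_cases hx : x ≤ L
    · have h := ih (L - x) x
      rw [Nat.cast_sub hx, sub_add_cancel] at h
      rw [if_pos hx, if_pos hx]
      simp only [tupleTerm_succ, zero_add, part_one_cons, part_cons, ← Finset.mul_sum,
        add_sub_cancel_right]
      rw [← h, show 2 * ((L : ℤ) + M) - M - x = 2 * L + M - x by ring]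
      ring
    · rw [if_neg hx, if_neg hx, mul_zero]

end Tuples

/-! ### Matching both sides with the iterated sum, for `k = m + 2` and `s = k - i` -/

section Main

theorem prod_Icc_one_eq_prod_range {R : Type*} [CommMonoid R] (N : ℕ) (f : ℕ → R) :
    ∏ j ∈ Finset.Icc 1 N, f j = ∏ j ∈ Finset.range N, f (j + 1) := by
  rw [Finset.range_eq_Ico, Finset.prod_Ico_add' f 0 N 1, zero_add,
    ← Finset.Ico_add_one_right_eq_Icc]

theorem sum_Icc_one_eq_sum_range {R : Type*} [AddCommMonoid R] (N : ℕ) (f : ℕ → R) :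
    ∑ j ∈ Finset.Icc 1 N, f j = ∑ j ∈ Finset.range N, f (j + 1) := by
  rw [Finset.range_eq_Ico, Finset.sum_Ico_add' f 0 N 1, zero_add,
    ← Finset.Ico_add_one_right_eq_Icc]

theorem fermionicTerm_eq_tupleTerm (m i s n : ℕ) (hi : 1 ≤ i) (his : i + s = m + 2)
    (v : Fin (m + 1) → ℕ) :
    fermionicTerm (m + 2) i n v = tupleTerm (X : ℤ[X]) s m n fun j => part v (j + 1) := by
  have he : ∑ j ∈ Finset.Icc 1 (m + 1), part v j ^ 2 + ∑ j ∈ Finset.Icc i (m + 1), part v j =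
      ∑ j ∈ Finset.range (m + 1),
        (part v (j + 1) ^ 2 + (if m + 1 - j ≤ s then 1 else 0) * part v (j + 1)) := by
    have hf : Finset.Icc i (m + 1) = {j ∈ Finset.Icc 1 (m + 1) | i ≤ j} := by
      ext j
      simp only [Finset.mem_Icc, Finset.mem_filter]
      omega
    rw [hf, Finset.sum_filter, ← Finset.sum_add_distrib, sum_Icc_one_eq_sum_range]
    refine Finset.sum_congr rfl fun j hj => ?_
    have := Finset.mem_range.1 hj
    by_cases h : i ≤ j + 1
    · rw [if_pos h, if_pos (by omega), one_mul]
    · rw [if_neg h, if_neg (by omega), zero_mul]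
  change X ^ (∑ j ∈ Finset.Icc 1 (m + 1), part v j ^ 2 + ∑ j ∈ Finset.Icc i (m + 1), part v j) *
    (∏ j ∈ Finset.Icc 1 m,
      gaussBinom X
        (2 * (n : ℤ) - 2 * ∑ l ∈ Finset.Ico 1 j, (part v l : ℤ) - part v j - part v (j + 1)
          + betaEntry (m + 2) i j)
        ((part v j : ℤ) - part v (j + 1))) *
    gaussBinom (X ^ 2) ((n : ℤ) - ∑ l ∈ Finset.Icc 1 m, (part v l : ℤ)) (part v (m + 1)) = _
  unfold tupleTerm
  rw [he, prod_Icc_one_eq_prod_range, sum_Icc_one_eq_sum_range]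
  congr 2
  refine Finset.prod_congr rfl fun j hj => ?_
  have hj := Finset.mem_range.1 hj
  -- Columns of the matrix count from one and `j` from zero, so `k - 1 - (j + 1) = m - j`.
  have hb : betaEntry (m + 2) i (j + 1) = (min s (m - j) : ℕ) := by
    unfold betaEntry
    omega
  rw [hb, Finset.range_eq_Ico, Finset.sum_Ico_add' (fun l => (part v l : ℤ)) 0 j 1, zero_add]

theorem sum_fermionicTerm (m i s n : ℕ) (hi : 1 ≤ i) (his : i + s = m + 2) :
    ∑ v ∈ decreasingTuples (m + 2) n, fermionicTerm (m + 2) i n v =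
      ∑ x ∈ Finset.range (n + 1), (X : ℤ[X]) ^ (x ^ 2 + (if m + 1 ≤ s then 1 else 0) * x) *
        burgeSum X s m (n - x) x := by
  rw [decreasingTuples_eq, Finset.sum_congr rfl
    fun v _ => fermionicTerm_eq_tupleTerm m i s n hi his v]
  refine (sum_boundedTuples_succ m n n _).trans ?_
  refine Finset.sum_congr rfl fun x hx => ?_
  have hx := Nat.lt_succ_iff.1 (Finset.mem_range.1 hx)
  rw [if_pos hx, pow_mul_burgeSum, Nat.cast_sub hx, sub_add_cancel]

theorem support_bosonicTerm_subset (k i n : ℕ) (hk : 2 ≤ k) (hi : 1 ≤ i) :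
    Function.support (bosonicTerm k i n) ⊆ Finset.Icc (-(n : ℤ) - 1) n := by
  intro r hr
  by_contra h
  refine hr ?_
  rw [Finset.mem_coe, Finset.mem_Icc, not_and_or, not_le, not_le] at h
  have hk' : (2 : ℤ) ≤ k := by exact_mod_cast hk
  have hn : (0 : ℤ) ≤ n := by positivity
  rw [bosonicTerm, gaussBinom_eq_zero, mul_zero]
  rcases h with h | h
  · right
    nlinarith
  · left
    nlinarith

theorem X_pow_ne_one (n : ℕ) : (X : ℤ[X]) ^ (n + 1) ≠ 1 := by
  intro h
  have := congrArg natDegree h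
  simp at this

theorem sum_bosonicTerm (m i s n : ℕ) (hi : 1 ≤ i) (his : i + s = m + 2) :
    ∑ r ∈ Finset.Icc (-(n : ℤ) - 1) n, bosonicTerm (m + 2) i n r =
      ∑ x ∈ Finset.range (n + 1), (X : ℤ[X]) ^ (x ^ 2 + (if m + 1 ≤ s then 1 else 0) * x) *
        burgeSum X s m (n - x) x := by
  have hi' : (i : ℤ) = m + 2 - s := by omega
  -- The first case is `i = 1`: even `n_1` has a linear term, so the shape for `ε = 1` is kept to
  -- the end. Otherwise `n_1` has none.
  rcases Nat.lt_or_ge m s with h | h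
  · obtain rfl : s = m + 1 := by omega
    rw [if_pos le_rfl, sum_burgeSum X_pow_ne_one (m + 1) m n 1 (Finset.Icc (-(n : ℤ) - 1) n) le_rfl
      (fun r => (-1) ^ r.natAbs * X ^ (r ^ 2 + m * (r ^ 2 + r)).toNat)
      (fun r => n + m * r + m) (fun r => n + 1 - m * r)]
    · refine Finset.sum_congr rfl fun r _ => ?_
      have h2 := sq_add_self_nonneg r
      rw [bosonicTerm, ← mul_assoc,
        mul_assoc ((-1) ^ r.natAbs) (X ^ (r ^ 2 + m * (r ^ 2 + r)).toNat),
        pow_toNat_mul_pow_toNat X (by positivity) (by simpa using h2), hi']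
      push_cast
      congr 2
      · congr 2; ring
      · ring
      · ring
    · intro x hx
      rw [burgeSum_eq_of_le X_pow_ne_one X_ne_zero (m + 1) n m (by omega) (n - x) x hx]
      push_cast [hx]
      simp only [sub_add_cancel]
    · intro r hr
      have : (0 : ℤ) ≤ m * r := by positivity
      push_cast
      constructor <;> nlinarith
    · intro r hr
      have : (m : ℤ) * (r + 1) ≤ 0 := mul_nonpos_of_nonneg_of_nonpos (by positivity) (by omega)
      constructor <;> nlinarith
  · obtain ⟨t, rfl⟩ := Nat.exists_eq_add_of_le h
    rw [if_neg (by omega), sum_burgeSum X_pow_ne_one s (s + t) n 0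
      (Finset.Icc (-(n : ℤ) - 1) n) zero_le_one
      (fun r => (-1) ^ r.natAbs * X ^ (r ^ 2 + s * (r ^ 2 + r) + t * r ^ 2).toNat)
      (fun r => n + (s + t) * r + s) (fun r => n - (s + t) * r)]
    · refine Finset.sum_congr rfl fun r _ => ?_
      have h2 := sq_add_self_nonneg r
      rw [bosonicTerm, ← mul_assoc,
        mul_assoc ((-1) ^ r.natAbs) (X ^ (r ^ 2 + s * (r ^ 2 + r) + t * r ^ 2).toNat),
        pow_toNat_mul_pow_toNat X (by positivity) (by simpa using sq_nonneg r), hi']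
      push_cast
      congr 2
      · congr 2; ring
      · ring
      · ring
    · intro x hx
      rw [burgeSum_add_eq X_pow_ne_one X_ne_zero s n t (n - x) x hx]
      push_cast [hx]
      simp only [sub_add_cancel, add_zero]
    · intro r hr
      have : (0 : ℤ) ≤ (s + t) * r := by positivity
      push_cast
      constructor <;> nlinarith
    · intro r hr
      have h1 : (s : ℤ) * (r + 1) ≤ 0 := mul_nonpos_of_nonneg_of_nonpos (by positivity) (by omega)
      have h2 : (t : ℤ) * r ≤ 0 := mul_nonpos_of_nonneg_of_nonpos (by positivity) (by omega)
      constructor <;> nlinarith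

end Main

theorem theorem2 (k i n : ℕ) (hk : 2 ≤ k) (hi : 1 ≤ i) (hik : i ≤ k) :
    (Function.support (bosonicTerm k i n)).Finite ∧
      ∑ᶠ r : ℤ, bosonicTerm k i n r = ∑ v ∈ decreasingTuples k n, fermionicTerm k i n v := by
  have hsub := support_bosonicTerm_subset k i n hk hi
  refine ⟨(Finset.finite_toSet _).subset hsub, ?_⟩
  rw [finsum_eq_sum_of_support_subset _ hsub]
  obtain ⟨m, rfl⟩ := Nat.exists_eq_add_of_le' hk
  obtain ⟨s, hs⟩ := Nat.exists_eq_add_of_le hik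
  rw [sum_bosonicTerm m i s n hi hs.symm, sum_fermionicTerm m i s n hi hs.symm]
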